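/- Let $d\ge 2$ and let $\Lambda\subset\mathbb R^d$ be a unimodular lattice (full rank, covolume $1$), with dual lattice $\Lambda^*=\{y\in\mathbb R^d:\langle y,x\rangle\in\mathbb Z\text{ for all }x\in\Lambda\}$. Let $\mathcal T=\{\tau\in\mathbb R^d:\tau_1+\dots+\tau_d=0\}$, and let $|\cdot|$ be the sup-norm. For $\tau\in\mathcal T$ put $\mathcal B_\tau=\operatorname{diag}(e^{\tau_1},\dots,e^{\tau_d})\,[-1,1]^d$. For $1\le k\le d$ let $\lambda_k(\mathcal B_\tau,\Lambda)$ be the $k$-th successive minimum, i.e. the infimum of the $\lambda>0$ such that $\lambda\mathcal B_\tau$ contains at least $k$ linearly independent vectors of $\Lambda$, and let $L_k(\tau,\Lambda)=\log\lambda_k(\mathcal B_\tau,\Lambda)$. Let $f:\mathcal T\to[0,\infty)$ be any function whose sublevel sets $\{\tau\in\mathcal T: f(\tau)\le r\}$, $r\in\mathbb R$, are all bounded (so that they form a monotone exhaustion of $\mathcal T$ by bounded sets), and let $f^*(\tau)=f(-\tau)$. Put $$\psi_k(\tau,\Lambda,f)=\frac{L_k(\tau,\Lambda)}{f(\tau)},\qquad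 \Psi_k(\tau,\Lambda,f)=\sum_{j=1}^k\psi_j(\tau,\Lambda,f)$$ (defined whenever $f(\tau)>0$, hence for all $\tau$ with $|\tau|$ large), and define the Schmidt–Summerer exponents, as elements of $[-\infty,+\infty]$, by $$\underline\psi_k(\Lambda,f)=\liminf_{|\tau|\to\infty}\psi_k,\quad \overline\psi_k(\Lambda,f)=\limsup_{|\tau|\to\infty}\psi_k,\quad \underline\Psi_k(\Lambda,f)=\liminf_{|\tau|\to\infty}\Psi_k,\quad \overline\Psi_k(\Lambda,f)=\limsup_{|\tau|\to\infty}\Psi_k .$$ Then, where the arguments $(\Lambda,f)$ are understood if omitted and $0\cdot(-\infty)=0$, the following hold. 1. $\underline\psi_k\le\underline\psi_{k+1}$ and $\overline\psi_k\le\overline\psi_{k+1}$ for $1\le k\le d-1$. 2. $\underline\Psi_1=\underline\psi_1\le0$ and $\overline\Psi_1=\overline\psi_1\le0$. 3. $\underline\Psi_{d-1}=-\overline\psi_d$ and $\overline\Psi_{d-1}=-\underline\psi_d$. 4. $\underline\Psi_d=\overline\Psi_d=0$. 5. For $1\le k\le d-1$: $\frac{k+1}{k}\underline\Psi_k\le\underline\Psi_{k+1}\le\frac{d-k-1}{d-k}\underline\Psi_k\le0$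 and $\frac{k+1}{k}\overline\Psi_k\le\overline\Psi_{k+1}\le\frac{d-k-1}{d-k}\overline\Psi_k\le0$. 6. $(d-1)\underline\Psi_1\le\underline\Psi_{d-1}\le\frac{\underline\Psi_1}{d-1}$ and $(d-1)\overline\Psi_1\le\overline\Psi_{d-1}\le\frac{\overline\Psi_1}{d-1}$. 7. For $1\le k\le d$: $\underline\psi_k(\Lambda,f)=-\overline\psi_{d+1-k}(\Lambda^*,f^*)$ and $\overline\psi_k(\Lambda,f)=-\underline\psi_{d+1-k}(\Lambda^*,f^*)$. 8. For $1\le k\le d-1$: $\underline\Psi_k(\Lambda,f)=\underline\Psi_{d-k}(\Lambda^*,f^*)$ and $\overline\Psi_k(\Lambda,f)=\overline\Psi_{d-k}(\Lambda^*,f^*)$. -/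

import Mathlib

open Filter

noncomputable section

namespace LatticeExponents

/-- The hyperplane `𝒯` of vectors `τ ∈ ℝ^d` with `τ₁ + ⋯ + τ_d = 0`, with the norm induced by the
sup-norm of `Fin d → ℝ`. -/
def traceZero (d : ℕ) : Submodule ℝ (Fin d → ℝ) where
  carrier := {τ | ∑ i, τ i = 0}
  add_mem' := by
    intro a b ha hb
    simp only [Set.mem_ofPred_eq, Pi.add_apply, Finset.sum_add_distrib] at *
    rw [ha, hb, add_zero]
  zero_mem' := by simp
  smul_mem' := by
    intro c a ha
    simp only [Set.mem_ofPred_eq, Pi.smul_apply, smul_eq_mul, ← Finset.mul_sum] at *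
    rw [ha, mul_zero]

/-- The parallelepiped `B_τ = D_τ B`, where `D_τ = diag(e^{τ₁}, …, e^{τ_d})` and `B` is the closed
unit ball of the sup-norm. -/
def box {d : ℕ} (τ : Fin d → ℝ) : Set (Fin d → ℝ) :=
  (fun x => (Matrix.diagonal fun i => Real.exp (τ i)).mulVec x) '' Metric.closedBall 0 1

/-- The `k`-th successive minimum of `B` with respect to `Λ`: the infimum of the positive `r` such
that `r B` contains at least `k` linearly independent vectors of `Λ`. -/
def successiveMinimum {d : ℕ} (k : ℕ) (B : Set (Fin d → ℝ)) (Λ : Submodule ℤ (Fin d → ℝ)) : ℝ :=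
  sInf {r : ℝ | 0 < r ∧ ∃ v : Fin k → (Fin d → ℝ), LinearIndependent ℝ v ∧
    ∀ i, v i ∈ Λ ∧ ∃ x ∈ B, v i = r • x}

/-- `L_k(τ, Λ) = log λ_k(B_τ, Λ)`. -/
def logMinimum {d : ℕ} (k : ℕ) (τ : traceZero d) (Λ : Submodule ℤ (Fin d → ℝ)) : ℝ :=
  Real.log (successiveMinimum k (box (τ : Fin d → ℝ)) Λ)

/-- The dual lattice: all `y` with `⟨y, x⟩ ∈ ℤ` for every `x ∈ Λ`. -/
def dualLattice {d : ℕ} (Λ : Submodule ℤ (Fin d → ℝ)) : Submodule ℤ (Fin d → ℝ) where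
  carrier := {y | ∀ x ∈ Λ, ∃ n : ℤ, y ⬝ᵥ x = (n : ℝ)}
  add_mem' := by
    intro a b ha hb x hx
    obtain ⟨m, hm⟩ := ha x hx
    obtain ⟨n, hn⟩ := hb x hx
    exact ⟨m + n, by rw [add_dotProduct, hm, hn]; push_cast; ring⟩
  zero_mem' := fun x _ => ⟨0, by simp⟩
  smul_mem' := by
    intro c a ha x hx
    obtain ⟨m, hm⟩ := ha x hx
    exact ⟨c * m, by rw [smul_dotProduct, hm]; simp⟩

/-- `f` is non-negative and its sublevel sets `{τ ∈ 𝒯 | f τ ≤ r}` exhaust `𝒯` by bounded sets.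
(These sets automatically increase with `r` and cover `𝒯`.) -/
structure IsExhausting {d : ℕ} (f : traceZero d → ℝ) : Prop where
  nonneg : ∀ τ, 0 ≤ f τ
  isBounded_sublevel : ∀ r : ℝ, Bornology.IsBounded {τ : traceZero d | f τ ≤ r}

/-- `f^*(τ) = f(-τ)`. -/
def reflect {d : ℕ} (f : traceZero d → ℝ) : traceZero d → ℝ := fun τ => f (-τ)

/-- `ψ_k(τ, Λ, f) = L_k(τ, Λ) / f(τ)`. -/
def psi {d : ℕ} (k : ℕ) (τ : traceZero d) (Λ : Submodule ℤ (Fin d → ℝ)) (f : traceZero d → ℝ) : ℝ :=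
  logMinimum k τ Λ / f τ

/-- `Ψ_k(τ, Λ, f) = ∑_{1 ≤ j ≤ k} ψ_j(τ, Λ, f)`. -/
def bigPsi {d : ℕ} (k : ℕ) (τ : traceZero d) (Λ : Submodule ℤ (Fin d → ℝ))
    (f : traceZero d → ℝ) : ℝ :=
  ∑ j ∈ Finset.Icc 1 k, psi j τ Λ f

/-- Schmidt–Summerer lower exponent of the first type: `liminf` of `ψ_k` as `|τ| → ∞`. -/
def lowerExp₁ {d : ℕ} (k : ℕ) (Λ : Submodule ℤ (Fin d → ℝ)) (f : traceZero d → ℝ) : EReal :=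
  liminf (fun τ => (psi k τ Λ f : EReal)) (Bornology.cobounded (traceZero d))

/-- Schmidt–Summerer upper exponent of the first type: `limsup` of `ψ_k` as `|τ| → ∞`. -/
def upperExp₁ {d : ℕ} (k : ℕ) (Λ : Submodule ℤ (Fin d → ℝ)) (f : traceZero d → ℝ) : EReal :=
  limsup (fun τ => (psi k τ Λ f : EReal)) (Bornology.cobounded (traceZero d))

/-- Schmidt–Summerer lower exponent of the second type: `liminf` of `Ψ_k` as `|τ| → ∞`. -/
def lowerExp₂ {d : ℕ} (k : ℕ) (Λ : Submodule ℤ (Fin d → ℝ)) (f : traceZero d → ℝ) : EReal :=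
  liminf (fun τ => (bigPsi k τ Λ f : EReal)) (Bornology.cobounded (traceZero d))

/-- Schmidt–Summerer upper exponent of the second type: `limsup` of `Ψ_k` as `|τ| → ∞`. -/
def upperExp₂ {d : ℕ} (k : ℕ) (Λ : Submodule ℤ (Fin d → ℝ)) (f : traceZero d → ℝ) : EReal :=
  limsup (fun τ => (bigPsi k τ Λ f : EReal)) (Bornology.cobounded (traceZero d))

end LatticeExponents

end

/-!
The successive minima of `Λ` with respect to the box `D_τ [-1, 1]^d` are those of `D_τ⁻¹ Λ` with
respect to the sup-norm. Minkowski's second theorem bounds `∑ L_k(τ, Λ)` and `∑ L_k(-τ, Λ*)` from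
above uniformly in `τ`, because `D_τ` preserves the covolume. Conversely `⟨y, x⟩` is an integer for
`x ∈ Λ` and `y ∈ Λ*`, so it has absolute value at least `1` unless it vanishes, which bounds
`L_k(τ, Λ) + L_{d+1-k}(-τ, Λ*)` from below. Together these force all of these quantities to be
bounded. Since the lower and upper growth rates relative to `f` ignore bounded errors, items 3, 4, 7
and 8 follow; the inequalities hold because the partial sums of a nondecreasing sequence are convex
in their length.
-/

noncomputable section

namespace LatticeExponents

open MeasureTheory

variable {d : ℕ}

section PartialSums

lemma sum_Icc_one_sub_sum_Icc_one {M : Type*} [AddCommGroup M] (x : ℕ → M) {i j : ℕ}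
    (hij : i ≤ j) :
    ∑ k ∈ Finset.Icc 1 j, x k - ∑ k ∈ Finset.Icc 1 i, x k = ∑ k ∈ Finset.Ioc i j, x k :=
  sub_eq_of_eq_add' (Finset.sum_Ioc_consecutive x i.zero_le hij).symm

lemma sum_Icc_one_pred_add {M : Type*} [AddCommMonoid M] (x : ℕ → M) {n : ℕ} (hn : 1 ≤ n) :
    ∑ k ∈ Finset.Icc 1 (n - 1), x k + x n = ∑ k ∈ Finset.Icc 1 n, x k := by
  obtain ⟨n, rfl⟩ := Nat.exists_eq_add_of_le' hn
  exact (Finset.sum_Icc_succ_top (by omega) x).symm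

lemma sum_Icc_one_reflect {M : Type*} [AddCommMonoid M] (x : ℕ → M) {k n : ℕ} (hkn : k ≤ n) :
    ∑ j ∈ Finset.Icc 1 k, x (n + 1 - j) = ∑ j ∈ Finset.Ioc (n - k) n, x j := by
  rw [← Finset.Ico_add_one_right_eq_Icc, Finset.sum_Ico_reflect x 1 (by omega)]
  congr 1
  ext j
  simp only [Finset.mem_Ico, Finset.mem_Ioc]
  omega

lemma sum_Icc_one_eq_sum_fin {M : Type*} [AddCommMonoid M] (x : ℕ → M) (n : ℕ) :
    ∑ j ∈ Finset.Icc 1 n, x j = ∑ i : Fin n, x (i + 1) := by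
  rw [Fin.sum_univ_eq_sum_range fun i => x (i + 1), Finset.range_eq_Ico, Finset.sum_Ico_add' x,
    zero_add, Finset.Ico_add_one_right_eq_Icc]

lemma sum_Icc_one_convex {R : Type*} [CommRing R] [LinearOrder R] [IsStrictOrderedRing R]
    {x : ℕ → R} {i j k n : ℕ} (hx : MonotoneOn x (Set.Icc 1 n)) (hij : i ≤ j)
    (hjk : j ≤ k) (hkn : k ≤ n) :
    ((k : R) - i) * ∑ l ∈ Finset.Icc 1 j, x l ≤
      ((k : R) - j) * ∑ l ∈ Finset.Icc 1 i, x l + ((j : R) - i) * ∑ l ∈ Finset.Icc 1 k, x l := by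
  obtain rfl | hj : j = 0 ∨ 1 ≤ j := by omega
  · simp [Nat.le_zero.1 hij]
  have left : ∑ l ∈ Finset.Ioc i j, x l ≤ ((j : R) - i) * x j := by
    rw [← Nat.cast_sub hij, ← nsmul_eq_mul, ← Nat.card_Ioc i j]
    refine Finset.sum_le_card_nsmul _ _ _ fun l hl => ?_
    rw [Finset.mem_Ioc] at hl
    exact hx ⟨by omega, by omega⟩ ⟨hj, by omega⟩ hl.2
  have right : ((k : R) - j) * x j ≤ ∑ l ∈ Finset.Ioc j k, x l := by
    rw [← Nat.cast_sub hjk, ← nsmul_eq_mul, ← Nat.card_Ioc j k]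
    refine Finset.card_nsmul_le_sum _ _ _ fun l hl => ?_
    rw [Finset.mem_Ioc] at hl
    exact hx ⟨hj, by omega⟩ ⟨by omega, by omega⟩ hl.1.le
  rw [← sum_Icc_one_sub_sum_Icc_one x hij] at left
  rw [← sum_Icc_one_sub_sum_Icc_one x hjk] at right
  have hij' : (0 : R) ≤ j - i := sub_nonneg.2 (Nat.cast_le.2 hij)
  have hjk' : (0 : R) ≤ k - j := sub_nonneg.2 (Nat.cast_le.2 hjk)
  linear_combination ((k : R) - j) * left + ((j : R) - i) * right

end PartialSums

section GrowthRate

variable {α : Type*} {F : Filter α} {f A B : α → ℝ} {C : ℝ}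

/-- The lower growth rate `liminf A / f` along `F`, for comparing a function `A` with a gauge `f`
that tends to infinity. -/
def lowerRate (F : Filter α) (f A : α → ℝ) : EReal :=
  liminf (fun a => ((A a / f a : ℝ) : EReal)) F

/-- The upper growth rate `limsup A / f` along `F`, the counterpart of `lowerRate`. -/
def upperRate (F : Filter α) (f A : α → ℝ) : EReal :=
  limsup (fun a => ((A a / f a : ℝ) : EReal)) F

lemma lowerRate_neg (F : Filter α) (f A : α → ℝ) :
    lowerRate F f (fun a => -A a) = -upperRate F f A := by
  simp only [lowerRate, upperRate, neg_div, EReal.coe_neg]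
  exact EReal.liminf_neg

/-- A functional on real functions that is monotone up to bounded errors and positively
homogeneous: the properties that `lowerRate` and `upperRate` share, so that an inequality between
functions can be transferred to both at once. -/
structure IsGrowthRate (Φ : (α → ℝ) → EReal) : Prop where
  le_of_le_add_const : ∀ {A B : α → ℝ} {C : ℝ}, (∀ a, A a ≤ B a + C) → Φ A ≤ Φ B
  const_mul : ∀ {c : ℝ}, 0 ≤ c → ∀ A : α → ℝ, Φ (fun a => c * A a) = c * Φ A

lemma isGrowthRate_lowerRate [F.NeBot] (hf : Tendsto f F atTop) :
    IsGrowthRate (lowerRate F f) where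
  le_of_le_add_const {A B C} h := by
    have error : limsup (fun a => ((C / f a : ℝ) : EReal)) F = 0 :=
      ((continuous_coe_real_ereal.tendsto 0).comp (hf.const_div_atTop C)).limsup_eq
    calc lowerRate F f A
        ≤ liminf ((fun a => ((C / f a : ℝ) : EReal)) + fun a => ((B a / f a : ℝ) : EReal)) F := by
          refine liminf_le_liminf ?_
          filter_upwards [hf.eventually_ge_atTop 0] with a ha
          rw [Pi.add_apply, ← EReal.coe_add, EReal.coe_le_coe_iff, ← add_div, add_comm]
          exact div_le_div_of_nonneg_right (h a) ha
      _ ≤ limsup (fun a => ((C / f a : ℝ) : EReal)) F + lowerRate F f B :=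
          EReal.liminf_add_le (by simp [error]) (by simp [error])
      _ = lowerRate F f B := by rw [error, zero_add]
  const_mul {c} hc A := by
    simp only [lowerRate, mul_div_assoc, EReal.coe_mul]
    exact EReal.liminf_const_mul_of_nonneg_of_ne_top (EReal.coe_nonneg.2 hc) (EReal.coe_ne_top c)

lemma isGrowthRate_upperRate [F.NeBot] (hf : Tendsto f F atTop) :
    IsGrowthRate (upperRate F f) := by
  have lower := isGrowthRate_lowerRate hf
  have upper_eq (A : α → ℝ) : upperRate F f A = -lowerRate F f fun a => -A a := by
    rw [lowerRate_neg, neg_neg]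
  refine ⟨fun {A B C} h => ?_, fun {c} hc A => ?_⟩
  · rw [upper_eq, upper_eq, EReal.neg_le_neg_iff]
    exact lower.le_of_le_add_const (C := C) fun a => by linarith [h a]
  · simp only [upper_eq, ← mul_neg, lower.const_mul hc]

namespace IsGrowthRate

variable {Φ : (α → ℝ) → EReal}

lemma mono (hΦ : IsGrowthRate Φ) (h : ∀ a, A a ≤ B a) : Φ A ≤ Φ B :=
  hΦ.le_of_le_add_const (C := 0) fun a => by simpa using h a

lemma congr (hΦ : IsGrowthRate Φ) (h : ∀ a, |A a - B a| ≤ C) : Φ A = Φ B :=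
  le_antisymm (hΦ.le_of_le_add_const (C := C) fun a => by linarith [le_of_abs_le (h a)])
    (hΦ.le_of_le_add_const (C := C) fun a => by linarith [neg_le_of_abs_le (h a)])

lemma eq_zero_of_bounded (hΦ : IsGrowthRate Φ) (h : ∀ a, |A a| ≤ C) : Φ A = 0 := by
  have zero : Φ (fun a => 0 * A a) = 0 := by simpa using hΦ.const_mul le_rfl A
  rw [← zero]
  exact hΦ.congr fun a => by simpa using h a

lemma div_mul_le_sum (hΦ : IsGrowthRate Φ) {x : α → ℕ → ℝ} {j k : ℕ}
    (hx : ∀ a, MonotoneOn (x a) (Set.Icc 1 k)) (hj : 0 < j) (hjk : j ≤ k) :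
    ((k / j : ℝ) : EReal) * Φ (fun a => ∑ l ∈ Finset.Icc 1 j, x a l) ≤
      Φ fun a => ∑ l ∈ Finset.Icc 1 k, x a l := by
  rw [← hΦ.const_mul (by positivity)]
  refine hΦ.mono fun a => ?_
  have convex := sum_Icc_one_convex (hx a) j.zero_le hjk le_rfl
  rw [div_mul_eq_mul_div, div_le_iff₀' (by positivity)]
  simpa using convex

lemma sum_le_div_mul (hΦ : IsGrowthRate Φ) {x : α → ℕ → ℝ} {i j n : ℕ}
    (hx : ∀ a, MonotoneOn (x a) (Set.Icc 1 n)) (htotal : ∀ a, |∑ l ∈ Finset.Icc 1 n, x a l| ≤ C)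
    (hij : i ≤ j) (hjn : j ≤ n) (hin : i < n) :
    Φ (fun a => ∑ l ∈ Finset.Icc 1 j, x a l) ≤
      (((n - j) / (n - i) : ℝ) : EReal) * Φ fun a => ∑ l ∈ Finset.Icc 1 i, x a l := by
  have hij' : (i : ℝ) ≤ j := Nat.cast_le.2 hij
  have hjn' : (j : ℝ) ≤ n := Nat.cast_le.2 hjn
  have hin' : (0 : ℝ) < n - i := sub_pos.2 (Nat.cast_lt.2 hin)
  rw [← hΦ.const_mul (div_nonneg (by linarith) hin'.le)]
  refine hΦ.le_of_le_add_const (C := C * (j - i) / (n - i)) fun a => ?_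
  have convex := sum_Icc_one_convex (hx a) hij hjn le_rfl
  have total := mul_le_mul_of_nonneg_left (le_of_abs_le (htotal a)) (sub_nonneg.2 hij')
  rw [div_mul_eq_mul_div, ← add_div, le_div_iff₀' hin']
  linarith

lemma sum_nonpos (hΦ : IsGrowthRate Φ) {x : α → ℕ → ℝ} {k n : ℕ}
    (hx : ∀ a, MonotoneOn (x a) (Set.Icc 1 n)) (htotal : ∀ a, |∑ l ∈ Finset.Icc 1 n, x a l| ≤ C)
    (hkn : k ≤ n) :
    Φ (fun a => ∑ l ∈ Finset.Icc 1 k, x a l) ≤ 0 := by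
  obtain rfl | hn : n = 0 ∨ 0 < n := by omega
  · exact (hΦ.eq_zero_of_bounded (C := 0) fun a => by simp [Nat.le_zero.1 hkn]).le
  · have zero : Φ (fun a => ∑ l ∈ Finset.Icc 1 0, x a l) = 0 :=
      hΦ.eq_zero_of_bounded (C := 0) fun a => by simp
    simpa only [zero, mul_zero] using hΦ.sum_le_div_mul hx htotal k.zero_le hkn hn

lemma sum_succ_bounds (hΦ : IsGrowthRate Φ) {x : α → ℕ → ℝ} {k n : ℕ}
    (hx : ∀ a, MonotoneOn (x a) (Set.Icc 1 n)) (htotal : ∀ a, |∑ l ∈ Finset.Icc 1 n, x a l| ≤ C)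
    (hk : 0 < k) (hkn : k < n) :
    (((k + 1) / k : ℝ) : EReal) * Φ (fun a => ∑ l ∈ Finset.Icc 1 k, x a l) ≤
        Φ (fun a => ∑ l ∈ Finset.Icc 1 (k + 1), x a l) ∧
      Φ (fun a => ∑ l ∈ Finset.Icc 1 (k + 1), x a l) ≤
        (((n - k - 1) / (n - k) : ℝ) : EReal) * Φ (fun a => ∑ l ∈ Finset.Icc 1 k, x a l) ∧
      (((n - k - 1) / (n - k) : ℝ) : EReal) * Φ (fun a => ∑ l ∈ Finset.Icc 1 k, x a l) ≤ 0 := by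
  have coeff_nonneg : (0 : ℝ) ≤ (n - k - 1) / (n - k) := by
    have hkn' : (k : ℝ) + 1 ≤ n := by exact_mod_cast hkn
    exact div_nonneg (by linarith) (by linarith)
  refine ⟨?_, ?_, mul_nonpos_of_nonneg_of_nonpos (EReal.coe_nonneg.2 coeff_nonneg)
    (hΦ.sum_nonpos hx htotal hkn.le)⟩
  · simpa using hΦ.div_mul_le_sum
      (fun a => (hx a).mono (Set.Icc_subset_Icc_right hkn)) hk k.le_succ
  · simpa [sub_sub] using hΦ.sum_le_div_mul hx htotal k.le_succ hkn hkn

lemma sum_pred_bounds (hΦ : IsGrowthRate Φ) {x : α → ℕ → ℝ} {n : ℕ}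
    (hx : ∀ a, MonotoneOn (x a) (Set.Icc 1 n)) (htotal : ∀ a, |∑ l ∈ Finset.Icc 1 n, x a l| ≤ C)
    (hn : 2 ≤ n) :
    ((n - 1 : ℝ) : EReal) * Φ (fun a => ∑ l ∈ Finset.Icc 1 1, x a l) ≤
        Φ (fun a => ∑ l ∈ Finset.Icc 1 (n - 1), x a l) ∧
      Φ (fun a => ∑ l ∈ Finset.Icc 1 (n - 1), x a l) ≤
        Φ (fun a => ∑ l ∈ Finset.Icc 1 1, x a l) / ((n - 1 : ℝ) : EReal) := by
  have cast_pred : ((n - 1 : ℕ) : ℝ) = n - 1 := by rw [Nat.cast_sub (by omega), Nat.cast_one]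
  constructor
  · simpa only [cast_pred, Nat.cast_one, div_one] using hΦ.div_mul_le_sum (j := 1) (k := n - 1)
      (fun a => (hx a).mono (Set.Icc_subset_Icc_right n.pred_le)) one_pos (by omega)
  · rw [EReal.div_eq_inv_mul, ← EReal.coe_inv]
    simpa only [cast_pred, Nat.cast_one, sub_sub_cancel, one_div] using
      hΦ.sum_le_div_mul (i := 1) (j := n - 1) hx htotal (by omega) n.pred_le (by omega)

end IsGrowthRate

lemma lowerRate_eq_neg_upperRate [F.NeBot] (hf : Tendsto f F atTop)
    (h : ∀ a, |A a + B a| ≤ C) : lowerRate F f A = -upperRate F f B := by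
  rw [← lowerRate_neg]
  exact (isGrowthRate_lowerRate hf).congr (C := C) fun a => by simpa using h a

lemma upperRate_eq_neg_lowerRate [F.NeBot] (hf : Tendsto f F atTop)
    (h : ∀ a, |A a + B a| ≤ C) : upperRate F f A = -lowerRate F f B := by
  rw [lowerRate_eq_neg_upperRate (A := B) (B := A) (C := C) hf fun a => by
    simpa only [add_comm] using h a, neg_neg]

end GrowthRate

section MinimalFamily

variable {E : Type*} [NormedAddCommGroup E] [NormedSpace ℝ E]

/-- A family of linearly independent lattice vectors, each of which is shortest among the lattice
vectors outside the span of its predecessors. Its norms are the successive minima of the unit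
ball. -/
structure IsMinimalFamily (Λ : Submodule ℤ E) {n : ℕ} (v : Fin n → E) : Prop where
  linearIndependent : LinearIndependent ℝ v
  mem : ∀ i, v i ∈ Λ
  norm_le : ∀ i, ∀ x ∈ Λ, x ∉ Submodule.span ℝ (v '' Set.Iio i) → ‖v i‖ ≤ ‖x‖

lemma exists_mem_forall_norm_le [FiniteDimensional ℝ E] (Λ : Submodule ℤ E) [DiscreteTopology Λ]
    {s : Set E} (hs : ((Λ : Set E) ∩ s).Nonempty) :
    ∃ x ∈ Λ, x ∈ s ∧ ∀ y ∈ Λ, y ∈ s → ‖x‖ ≤ ‖y‖ := by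
  obtain ⟨x₀, hx₀Λ, hx₀s⟩ := hs
  have discrete : DiscreteTopology Λ.toAddSubgroup := ‹DiscreteTopology Λ›
  have closed : IsClosed (Λ : Set E) := AddSubgroup.isClosed_of_discrete (H := Λ.toAddSubgroup)
  have finite : (Metric.closedBall 0 ‖x₀‖ ∩ (Λ : Set E)).Finite :=
    Metric.finite_isBounded_inter_isClosed (isDiscrete_iff_discreteTopology.2 ‹_›)
      Metric.isBounded_closedBall closed
  obtain ⟨x, ⟨⟨hxx₀, hxΛ⟩, hxs⟩, hmin⟩ := Set.exists_min_image _ (fun x : E => ‖x‖)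
    (finite.inter_of_left s) ⟨x₀, ⟨by simp, hx₀Λ⟩, hx₀s⟩
  refine ⟨x, hxΛ, hxs, fun y hyΛ hys => ?_⟩
  by_cases hy : y ∈ Metric.closedBall 0 ‖x₀‖
  · exact hmin y ⟨⟨hy, hyΛ⟩, hys⟩
  · rw [mem_closedBall_zero_iff] at hy hxx₀
    exact hxx₀.trans (le_of_not_ge hy)

lemma exists_mem_notMem_span_range (Λ : Submodule ℤ E) [DiscreteTopology Λ] [IsZLattice ℝ Λ]
    {n : ℕ} (hn : n < Module.finrank ℝ E) (v : Fin n → E) :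
    ∃ x ∈ Λ, x ∉ Submodule.span ℝ (Set.range v) := by
  by_contra! h
  have span_eq_top : Submodule.span ℝ (Set.range v) = ⊤ := by
    rw [← top_le_iff, ← IsZLattice.span_top (K := ℝ) (L := Λ), Submodule.span_le]
    exact h
  have finrank_le := finrank_range_le_card (R := ℝ) v
  rw [Set.finrank, span_eq_top, finrank_top, Fintype.card_fin] at finrank_le
  exact hn.not_ge finrank_le

namespace IsMinimalFamily

variable {Λ : Submodule ℤ E} {n : ℕ} {v : Fin n → E}

lemma snoc (hv : IsMinimalFamily Λ v) {x : E} (hxΛ : x ∈ Λ)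
    (hxv : x ∉ Submodule.span ℝ (Set.range v))
    (hmin : ∀ y ∈ Λ, y ∉ Submodule.span ℝ (Set.range v) → ‖x‖ ≤ ‖y‖) :
    IsMinimalFamily Λ (Fin.snoc v x : Fin (n + 1) → E) := by
  have image_castSucc (i : Fin n) :
      (Fin.snoc v x : Fin (n + 1) → E) '' Set.Iio i.castSucc = v '' Set.Iio i := by
    rw [← Fin.image_castSucc_Iio, Set.image_image]
    simp only [Fin.snoc_castSucc]
  have image_last : (Fin.snoc v x : Fin (n + 1) → E) '' Set.Iio (Fin.last n) = Set.range v := by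
    have range_castSucc : Set.Iio (Fin.last n) = Set.range Fin.castSucc := by
      ext j
      simp [Fin.range_castSucc, Fin.lt_def]
    rw [range_castSucc, ← Set.range_comp]
    simp only [Function.comp_def, Fin.snoc_castSucc]
  refine ⟨linearIndependent_finSnoc.2 ⟨hv.linearIndependent, hxv⟩, ?_, ?_⟩
  · exact Fin.lastCases (by simpa using hxΛ) fun i => by simpa using hv.mem i
  · refine Fin.lastCases ?_ fun i => ?_
    · simpa only [image_last, Fin.snoc_last] using hmin
    · simpa only [image_castSucc, Fin.snoc_castSucc] using hv.norm_le i

lemma norm_pos (hv : IsMinimalFamily Λ v) (i : Fin n) : 0 < ‖v i‖ :=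
  norm_pos_iff.2 (hv.linearIndependent.ne_zero i)

lemma monotone_norm (hv : IsMinimalFamily Λ v) : Monotone fun i => ‖v i‖ := fun i j hij =>
  hv.norm_le i (v j) (hv.mem j) (hv.linearIndependent.notMem_span_image (by simpa using hij))

lemma exists_norm_le (hv : IsMinimalFamily Λ v) (i : Fin n) {w : Fin (i + 1) → E}
    (hw : LinearIndependent ℝ w) (hwΛ : ∀ j, w j ∈ Λ) : ∃ j, ‖v i‖ ≤ ‖w j‖ := by
  by_contra! h
  have span_le : Submodule.span ℝ (Set.range w) ≤ Submodule.span ℝ (v '' Set.Iio i) := by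
    rw [Submodule.span_le]
    rintro _ ⟨j, rfl⟩
    by_contra hj
    exact (h j).not_ge (hv.norm_le i _ (hwΛ j) hj)
  have finite := FiniteDimensional.span_of_finite ℝ ((Set.finite_Iio i).image v)
  have finrank_le := Submodule.finrank_mono span_le
  have li_Iio : LinearIndependent ℝ fun j : Set.Iio i => v j :=
    hv.linearIndependent.comp _ Subtype.val_injective
  rw [Set.image_eq_range, finrank_span_eq_card hw, finrank_span_eq_card li_Iio] at finrank_le
  simp at finrank_le

end IsMinimalFamily

lemma exists_isMinimalFamily [FiniteDimensional ℝ E] (Λ : Submodule ℤ E) [DiscreteTopology Λ]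
    [IsZLattice ℝ Λ] {n : ℕ} (hn : n ≤ Module.finrank ℝ E) :
    ∃ v : Fin n → E, IsMinimalFamily Λ v := by
  induction n with
  | zero => exact ⟨Fin.elim0, linearIndependent_empty_type, fun i => i.elim0, fun i => i.elim0⟩
  | succ n ih =>
    obtain ⟨v, hv⟩ := ih (by omega)
    obtain ⟨x, hxΛ, hxv, hmin⟩ := exists_mem_forall_norm_le Λ
      (exists_mem_notMem_span_range Λ (by omega) v)
    exact ⟨Fin.snoc v x, hv.snoc hxΛ hxv hmin⟩

end MinimalFamily

section SuccessiveMinima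

lemma successiveMinimum_image_equiv (e : (Fin d → ℝ) ≃ₗ[ℝ] (Fin d → ℝ)) (k : ℕ)
    (B : Set (Fin d → ℝ)) (Λ : Submodule ℤ (Fin d → ℝ)) :
    successiveMinimum k (e '' B) Λ = successiveMinimum k B (ZLattice.comap ℝ Λ e) := by
  refine congrArg sInf (Set.ext fun r => and_congr_right fun _ => ⟨?_, ?_⟩)
  · rintro ⟨v, hv, hvΛ⟩
    refine ⟨e.symm ∘ v, hv.map' _ e.symm.ker, fun i => ?_⟩
    obtain ⟨hi, _, ⟨x, hx, rfl⟩, hvx⟩ := hvΛ i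
    exact ⟨by simpa [ZLattice.comap] using hi, x, hx, by simp [hvx]⟩
  · rintro ⟨v, hv, hvΛ⟩
    refine ⟨e ∘ v, hv.map' _ e.ker, fun i => ?_⟩
    obtain ⟨hi, x, hx, hvx⟩ := hvΛ i
    exact ⟨hi, e x, ⟨x, hx, rfl⟩, by simp [hvx]⟩

lemma IsMinimalFamily.successiveMinimum_closedBall {Λ : Submodule ℤ (Fin d → ℝ)} {n : ℕ}
    {v : Fin n → Fin d → ℝ} (hv : IsMinimalFamily Λ v) (i : Fin n) :
    successiveMinimum (i + 1) (Metric.closedBall 0 1) Λ = ‖v i‖ := by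
  have mem_smul_iff {r : ℝ} (hr : 0 < r) (y : Fin d → ℝ) :
      (∃ x ∈ Metric.closedBall (0 : Fin d → ℝ) 1, y = r • x) ↔ ‖y‖ ≤ r := by
    rw [← mem_closedBall_zero_iff, ← smul_unitClosedBall_of_nonneg hr.le, Set.mem_smul_set]
    simp only [eq_comm]
  refine IsLeast.csInf_eq ⟨⟨hv.norm_pos i, fun j => v (Fin.castLE i.2 j), ?_, fun j => ?_⟩, ?_⟩
  · exact hv.linearIndependent.comp _ (Fin.castLE_injective _)
  · exact ⟨hv.mem _, (mem_smul_iff (hv.norm_pos i) _).2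
      (hv.monotone_norm (Fin.le_def.2 (Nat.lt_succ_iff.1 j.2)))⟩
  · rintro r ⟨hr, w, hw, hwr⟩
    obtain ⟨j, hj⟩ := hv.exists_norm_le i hw fun j => (hwr j).1
    exact hj.trans ((mem_smul_iff hr _).1 (hwr j).2)

end SuccessiveMinima

section DiagonalFlow

variable {ι : Type*} [Fintype ι]

/-- The diagonal map `D_τ = diag(e^{τ₁}, …, e^{τ_d})`. -/
def expDiagonal (τ : ι → ℝ) : (ι → ℝ) ≃L[ℝ] (ι → ℝ) :=
  ContinuousLinearEquiv.piCongrRight fun i =>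
    ContinuousLinearEquiv.unitsEquivAut ℝ (Units.mk0 (Real.exp (τ i)) (Real.exp_ne_zero _))

lemma expDiagonal_eq_mulVec [DecidableEq ι] (τ x : ι → ℝ) :
    expDiagonal τ x = (Matrix.diagonal fun i => Real.exp (τ i)).mulVec x := by
  ext i
  simp [expDiagonal, Matrix.mulVec_diagonal, mul_comm]

lemma measurePreserving_expDiagonal {τ : ι → ℝ} (hτ : ∑ i, τ i = 0) :
    MeasurePreserving (expDiagonal τ) := by
  classical
  have det_eq_one : (Matrix.diagonal fun i => Real.exp (τ i)).det = 1 := by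
    rw [Matrix.det_diagonal, ← Real.exp_sum, hτ, Real.exp_zero]
  have map_eq := Real.map_matrix_volume_pi_eq_smul_volume_pi (det_eq_one.trans_ne one_ne_zero)
  refine ⟨(expDiagonal τ).continuous.measurable, ?_⟩
  rw [det_eq_one, inv_one, abs_one, ENNReal.ofReal_one, one_smul] at map_eq
  rwa [funext (expDiagonal_eq_mulVec τ)]

/-- The lattice `D_τ⁻¹ Λ`, whose successive minima with respect to the unit ball of the sup-norm
are those of `Λ` with respect to `D_τ [-1, 1]^d`. -/
def diagonalFlow (τ : ι → ℝ) (Λ : Submodule ℤ (ι → ℝ)) : Submodule ℤ (ι → ℝ) :=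
  ZLattice.comap ℝ Λ (expDiagonal τ).toLinearMap

instance (τ : ι → ℝ) (Λ : Submodule ℤ (ι → ℝ)) [DiscreteTopology Λ] :
    DiscreteTopology (diagonalFlow τ Λ) :=
  inferInstanceAs (DiscreteTopology (ZLattice.comap ℝ Λ (expDiagonal τ).toLinearMap))

instance (τ : ι → ℝ) (Λ : Submodule ℤ (ι → ℝ)) [DiscreteTopology Λ] [IsZLattice ℝ Λ] :
    IsZLattice ℝ (diagonalFlow τ Λ) :=
  inferInstanceAs (IsZLattice ℝ (ZLattice.comap ℝ Λ (expDiagonal τ).toLinearMap))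

lemma covolume_diagonalFlow (Λ : Submodule ℤ (ι → ℝ)) [DiscreteTopology Λ] [IsZLattice ℝ Λ]
    {τ : ι → ℝ} (hτ : ∑ i, τ i = 0) :
    ZLattice.covolume (diagonalFlow τ Λ) = ZLattice.covolume Λ :=
  ZLattice.covolume_comap Λ volume volume (measurePreserving_expDiagonal hτ)

lemma successiveMinimum_box (k : ℕ) (τ : Fin d → ℝ) (Λ : Submodule ℤ (Fin d → ℝ)) :
    successiveMinimum k (box τ) Λ =
      successiveMinimum k (Metric.closedBall 0 1) (diagonalFlow τ Λ) := by
  rw [box, ← funext (expDiagonal_eq_mulVec τ)]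
  exact successiveMinimum_image_equiv (expDiagonal τ).toLinearEquiv k _ Λ

lemma IsMinimalFamily.logMinimum_eq {τ : traceZero d} {Λ : Submodule ℤ (Fin d → ℝ)} {n : ℕ}
    {v : Fin n → Fin d → ℝ} (hv : IsMinimalFamily (diagonalFlow (τ : Fin d → ℝ) Λ) v)
    (i : Fin n) : logMinimum (i + 1) τ Λ = Real.log ‖v i‖ := by
  rw [logMinimum, successiveMinimum_box, hv.successiveMinimum_closedBall]

end DiagonalFlow

section Minkowski

lemma exists_mem_ne_zero_forall_abs_lt {ι : Type*} [Fintype ι] (Λ : Submodule ℤ (ι → ℝ))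
    [DiscreteTopology Λ] [IsZLattice ℝ Λ] {r : ι → ℝ} (hr : ∀ i, 0 < r i)
    (hlt : ZLattice.covolume Λ < ∏ i, r i) :
    ∃ x ∈ Λ, x ≠ 0 ∧ ∀ i, |x i| < r i := by
  let s : Set (ι → ℝ) := Set.univ.pi fun i => Set.Ioo (-r i) (r i)
  let b := Module.Free.chooseBasis ℤ Λ
  have fundamental := ZLattice.isAddFundamentalDomain b volume
  have neg_mem : ∀ x ∈ s, -x ∈ s := fun x hx i hi =>
    ⟨neg_lt_neg (hx i hi).2, neg_lt.1 (hx i hi).1⟩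
  have volume_s : volume s = ENNReal.ofReal (∏ i, r i) * 2 ^ Fintype.card ι := by
    rw [Real.volume_pi_Ioo, ENNReal.ofReal_prod_of_nonneg fun i _ => (hr i).le, ← Finset.card_univ,
      ← Finset.prod_const, ← Finset.prod_mul_distrib]
    refine Finset.prod_congr rfl fun i _ => ?_
    rw [sub_neg_eq_add, ← mul_two, ENNReal.ofReal_mul (hr i).le, ENNReal.ofReal_ofNat]
  have volume_lt : volume (ZSpan.fundamentalDomain (b.ofZLatticeBasis ℝ)) *
      2 ^ Module.finrank ℝ (ι → ℝ) < volume s := by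
    have finite : volume (ZSpan.fundamentalDomain (b.ofZLatticeBasis ℝ)) ≠ ⊤ :=
      (ZSpan.fundamentalDomain_isBounded _).measure_lt_top.ne
    rw [volume_s, Module.finrank_fintype_fun_eq_card, ← ENNReal.ofReal_toReal finite,
      ← measureReal_def, ← ZLattice.covolume_eq_measure_fundamentalDomain Λ volume fundamental]
    gcongr
    · exact ENNReal.pow_ne_top ENNReal.ofNat_ne_top
    · exact (ENNReal.ofReal_lt_ofReal_iff (Finset.prod_pos fun i _ => hr i)).2 hlt
  have : Countable Λ.toAddSubgroup := inferInstanceAs (Countable Λ)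
  obtain ⟨x, hx0, hx⟩ := exists_ne_zero_mem_lattice_of_measure_mul_two_pow_lt_measure
    (L := Λ.toAddSubgroup) fundamental neg_mem
    (convex_pi fun i _ => convex_Ioo (-r i) (r i)) volume_lt
  exact ⟨x, x.2, fun h => hx0 (Subtype.ext h), fun i => abs_lt.2 (hx i (Set.mem_univ i))⟩

lemma exists_measurePreserving_triangular {ι : Type*} [Fintype ι] [LinearOrder ι]
    [LocallyFiniteOrderBot ι] [WellFoundedLT ι] (v : ι → ι → ℝ) :
    ∃ φ : (ι → ℝ) ≃L[ℝ] (ι → ℝ), MeasurePreserving φ ∧ (∀ x, ‖x‖ ≤ ∑ j, |φ x j|) ∧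
      ∀ i j, i < j → φ (v i) j = 0 := by
  let b := InnerProductSpace.gramSchmidtOrthonormalBasis (𝕜 := ℝ)
    (finrank_euclideanSpace (𝕜 := ℝ) (ι := ι)) fun i => WithLp.toLp 2 (v i)
  let euclidean := PiLp.continuousLinearEquiv 2 ℝ fun _ : ι => ℝ
  let φ := euclidean.symm.trans (b.repr.toContinuousLinearEquiv.trans euclidean)
  refine ⟨φ, ?_, fun x => ?_, fun i j hij =>
    InnerProductSpace.gramSchmidtOrthonormalBasis_inv_triangular' _ _ hij⟩
  · exact (PiLp.volume_preserving_ofLp ι).comp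
      (b.measurePreserving_repr.comp (PiLp.volume_preserving_toLp ι))
  · calc ‖x‖ ≤ ‖WithLp.toLp 2 x‖ :=
          (pi_norm_le_iff_of_nonneg (norm_nonneg _)).2 (PiLp.norm_apply_le (WithLp.toLp 2 x))
      _ = ‖∑ j, φ x j • b j‖ := by rw [← b.sum_repr (WithLp.toLp 2 x)]; rfl
      _ ≤ ∑ j, |φ x j| := by
          refine norm_sum_le_of_le _ fun j _ => ?_
          rw [norm_smul, b.norm_eq_one, mul_one, Real.norm_eq_abs]

lemma exists_mem_ne_zero_forall_abs_apply_lt {ι : Type*} [Fintype ι] (Λ : Submodule ℤ (ι → ℝ))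
    [DiscreteTopology Λ] [IsZLattice ℝ Λ] {φ : (ι → ℝ) ≃L[ℝ] (ι → ℝ)} (hφ : MeasurePreserving φ)
    {r : ι → ℝ} (hr : ∀ i, 0 < r i) (hlt : ZLattice.covolume Λ < ∏ i, r i) :
    ∃ x ∈ Λ, x ≠ 0 ∧ ∀ i, |φ x i| < r i := by
  have hφ_symm : MeasurePreserving φ.symm := hφ.symm φ.toHomeomorph.toMeasurableEquiv
  rw [← ZLattice.covolume_comap Λ volume volume hφ_symm] at hlt
  obtain ⟨y, hy, hy0, hyr⟩ := exists_mem_ne_zero_forall_abs_lt _ hr hlt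
  exact ⟨φ.symm y, hy, by simpa using hy0, by simpa using hyr⟩

theorem IsMinimalFamily.prod_norm_le {Λ : Submodule ℤ (Fin d → ℝ)} [DiscreteTopology Λ]
    [IsZLattice ℝ Λ] {v : Fin d → Fin d → ℝ} (hv : IsMinimalFamily Λ v) :
    ∏ i, ‖v i‖ ≤ (d : ℝ) ^ d * ZLattice.covolume Λ := by
  -- Otherwise some nonzero `x ∈ Λ` has `j`-th triangular coordinate smaller than `‖v j‖ / d`.
  -- If `i` is its last nonzero coordinate, then `x` is independent of the `v j` with `j < i`, yet
  -- shorter than `v i`.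
  by_contra! hlt
  have hd (j : Fin d) : (0 : ℝ) < d := Nat.cast_pos.2 j.pos
  have covolume_lt : ZLattice.covolume Λ < ∏ j, ‖v j‖ / d := by
    rw [Finset.prod_div_distrib, Finset.prod_const, Finset.card_univ, Fintype.card_fin,
      lt_div_iff₀' (by exact_mod_cast Nat.pow_self_pos)]
    exact hlt
  obtain ⟨φ, hφ, norm_le, triangular⟩ := exists_measurePreserving_triangular v
  obtain ⟨x, hxΛ, hx0, hx⟩ := exists_mem_ne_zero_forall_abs_apply_lt Λ hφ
    (fun j => div_pos (hv.norm_pos j) (hd j)) covolume_lt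
  obtain ⟨i, hi⟩ := Set.Finite.exists_maximal (Set.toFinite {j | φ x j ≠ 0})
    (Function.ne_iff.1 (φ.map_ne_zero_iff.2 hx0))
  have notMem_span : x ∉ Submodule.span ℝ (v '' Set.Iio i) := by
    have span_le : Submodule.span ℝ (v '' Set.Iio i) ≤
        LinearMap.ker (LinearMap.proj i ∘ₗ φ.toLinearMap) := by
      rw [Submodule.span_le]
      rintro _ ⟨j, hj, rfl⟩
      exact triangular j i hj
    exact fun h => hi.prop (span_le h)
  have abs_le (j : Fin d) : |φ x j| ≤ ‖v i‖ / d := by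
    obtain hj | hj := le_or_gt j i
    · exact (hx j).le.trans (by gcongr; exact hv.monotone_norm hj)
    · rw [not_not.1 fun h => hi.not_gt h hj, abs_zero]
      positivity
  have norm_lt : ‖x‖ < ‖v i‖ :=
    calc ‖x‖ ≤ ∑ j, |φ x j| := norm_le x
      _ < ∑ _j : Fin d, ‖v i‖ / d :=
          Finset.sum_lt_sum (fun j _ => abs_le j) ⟨i, Finset.mem_univ i, hx i⟩
      _ = ‖v i‖ := by simp [mul_div_cancel₀, (hd i).ne']
  exact norm_lt.not_ge (hv.norm_le i x hxΛ notMem_span)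

end Minkowski

section Duality

lemma exists_basis_span_eq_dualLattice (Λ : Submodule ℤ (Fin d → ℝ)) [DiscreteTopology Λ]
    [IsZLattice ℝ Λ] :
    ∃ b : Module.Basis (Fin d) ℝ (Fin d → ℝ), Submodule.span ℤ (Set.range b) = dualLattice Λ := by
  let B : LinearMap.BilinForm ℝ (Fin d → ℝ) := dotProductBilin ℝ ℝ
  have nondegenerate : B.Nondegenerate :=
    ⟨fun x hx => dotProduct_eq_zero x hx,
      fun y hy => dotProduct_eq_zero y fun x => (dotProduct_comm y x).trans (hy x)⟩
  let b₀ := (Module.Free.chooseBasis ℤ Λ).ofZLatticeBasis ℝ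
  let b := b₀.reindex (b₀.indexEquiv (Pi.basisFun ℝ (Fin d)))
  have span_eq : Submodule.span ℤ (Set.range b) = Λ := by
    rw [Module.Basis.range_reindex]
    exact (Module.Free.chooseBasis ℤ Λ).ofZLatticeBasis_span ℝ
  refine ⟨B.dualBasis nondegenerate b, ?_⟩
  rw [← LinearMap.BilinForm.dualSubmodule_span_of_basis, span_eq]
  refine Submodule.ext fun y => forall₂_congr fun x _ => ?_
  simp only [Submodule.mem_one, eq_comm (b := B y x), eq_intCast]
  rfl

instance (Λ : Submodule ℤ (Fin d → ℝ)) [DiscreteTopology Λ] [IsZLattice ℝ Λ] :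
    DiscreteTopology (dualLattice Λ) := by
  obtain ⟨b, hb⟩ := exists_basis_span_eq_dualLattice Λ
  rw [← hb]
  infer_instance

instance (Λ : Submodule ℤ (Fin d → ℝ)) [DiscreteTopology Λ] [IsZLattice ℝ Λ] :
    IsZLattice ℝ (dualLattice Λ) := by
  obtain ⟨b, hb⟩ := exists_basis_span_eq_dualLattice Λ
  exact ⟨by rw [← hb, ZSpan.span_top]⟩

lemma dualLattice_diagonalFlow (τ : Fin d → ℝ) (Λ : Submodule ℤ (Fin d → ℝ)) :
    dualLattice (diagonalFlow τ Λ) = diagonalFlow (-τ) (dualLattice Λ) := by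
  have dotProduct_eq (y x : Fin d → ℝ) :
      expDiagonal (-τ) y ⬝ᵥ expDiagonal τ x = y ⬝ᵥ x := by
    simp only [expDiagonal_eq_mulVec, dotProduct, Matrix.mulVec_diagonal, Pi.neg_apply,
      Real.exp_neg]
    exact Finset.sum_congr rfl fun i _ => by field_simp
  ext y
  constructor
  · intro hy x hx
    obtain ⟨x, rfl⟩ := (expDiagonal τ).surjective x
    exact (dotProduct_eq y x).symm ▸ hy x hx
  · intro hy x hx
    exact dotProduct_eq y x ▸ hy _ hx

lemma abs_dotProduct_le {ι : Type*} [Fintype ι] (x y : ι → ℝ) :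
    |x ⬝ᵥ y| ≤ Fintype.card ι * (‖x‖ * ‖y‖) :=
  calc |x ⬝ᵥ y| ≤ ∑ i, |x i * y i| := Finset.abs_sum_le_sum_abs _ _
    _ ≤ ∑ _i : ι, ‖x‖ * ‖y‖ := by
        refine Finset.sum_le_sum fun i _ => ?_
        rw [abs_mul]
        exact mul_le_mul (norm_le_pi_norm x i) (norm_le_pi_norm y i) (abs_nonneg _)
          (norm_nonneg _)
    _ = Fintype.card ι * (‖x‖ * ‖y‖) := by simp

lemma exists_dotProduct_ne_zero {v w : Fin d → Fin d → ℝ} (hv : LinearIndependent ℝ v)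
    (hw : LinearIndependent ℝ w) (i : Fin d) : ∃ a ≤ i, ∃ b ≤ i.rev, w b ⬝ᵥ v a ≠ 0 := by
  -- Two orthogonal subspaces cannot have dimensions `i + 1` and `d - i`.
  by_contra! orthogonal
  let V : Matrix (Set.Iic i) (Fin d) ℝ := Matrix.of fun a => v a
  let W : Matrix (Set.Iic i.rev) (Fin d) ℝ := Matrix.of fun b => w b
  have rank_V : V.rank = Fintype.card (Set.Iic i) :=
    LinearIndependent.rank_matrix (hv.comp _ Subtype.val_injective)
  have rank_W : W.rank = Fintype.card (Set.Iic i.rev) :=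
    LinearIndependent.rank_matrix (hw.comp _ Subtype.val_injective)
  have mul_eq_zero : W * V.transpose = 0 := by
    ext b a
    exact orthogonal a a.2 b b.2
  have rank_add_le := Matrix.rank_add_rank_le_card_of_mul_eq_zero mul_eq_zero
  rw [Matrix.rank_transpose, rank_V, rank_W] at rank_add_le
  simp [Fin.val_rev] at rank_add_le
  omega

lemma IsMinimalFamily.one_le_mul_norm_rev {Λ : Submodule ℤ (Fin d → ℝ)}
    {v w : Fin d → Fin d → ℝ} (hv : IsMinimalFamily Λ v)
    (hw : IsMinimalFamily (dualLattice Λ) w) (i : Fin d) : 1 ≤ d * (‖v i‖ * ‖w i.rev‖) := by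
  obtain ⟨a, ha, b, hb, hab⟩ :=
    exists_dotProduct_ne_zero hv.linearIndependent hw.linearIndependent i
  obtain ⟨n, hn⟩ := hw.mem b (v a) (hv.mem a)
  rw [hn, Int.cast_ne_zero] at hab
  calc (1 : ℝ) ≤ |(n : ℝ)| := by exact_mod_cast Int.one_le_abs hab
    _ ≤ d * (‖w b‖ * ‖v a‖) := by
        rw [← hn]
        simpa using abs_dotProduct_le (w b) (v a)
    _ ≤ d * (‖v i‖ * ‖w i.rev‖) := by
        rw [mul_comm ‖w b‖]
        gcongr
        exacts [hv.monotone_norm ha, hw.monotone_norm hb]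

end Duality

section LogMinima

lemma exists_isMinimalFamily_diagonalFlow (τ : Fin d → ℝ) (Λ : Submodule ℤ (Fin d → ℝ))
    [DiscreteTopology Λ] [IsZLattice ℝ Λ] :
    ∃ v : Fin d → Fin d → ℝ, IsMinimalFamily (diagonalFlow τ Λ) v :=
  exists_isMinimalFamily _ (Module.finrank_fin_fun ℝ).ge

lemma exists_fin_val_add_one_eq {k : ℕ} (hk : k ∈ Set.Icc 1 d) : ∃ i : Fin d, (i : ℕ) + 1 = k :=
  ⟨⟨k - 1, by grind⟩, by grind⟩

lemma monotoneOn_logMinimum (τ : traceZero d) (Λ : Submodule ℤ (Fin d → ℝ))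
    [DiscreteTopology Λ] [IsZLattice ℝ Λ] :
    MonotoneOn (fun k => logMinimum k τ Λ) (Set.Icc 1 d) := by
  obtain ⟨v, hv⟩ := exists_isMinimalFamily_diagonalFlow (τ : Fin d → ℝ) Λ
  intro j hj k hk hjk
  obtain ⟨a, rfl⟩ := exists_fin_val_add_one_eq hj
  obtain ⟨b, rfl⟩ := exists_fin_val_add_one_eq hk
  simp only [hv.logMinimum_eq]
  exact Real.log_le_log (hv.norm_pos a) (hv.monotone_norm (by simpa using hjk))

lemma sum_logMinimum_le (τ : traceZero d) (Λ : Submodule ℤ (Fin d → ℝ)) [DiscreteTopology Λ]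
    [IsZLattice ℝ Λ] :
    ∑ j ∈ Finset.Icc 1 d, logMinimum j τ Λ ≤ Real.log ((d : ℝ) ^ d * ZLattice.covolume Λ) := by
  obtain ⟨v, hv⟩ := exists_isMinimalFamily_diagonalFlow (τ : Fin d → ℝ) Λ
  simp only [sum_Icc_one_eq_sum_fin, hv.logMinimum_eq]
  rw [← Real.log_prod fun i _ => (hv.norm_pos i).ne', ← covolume_diagonalFlow Λ τ.2]
  exact Real.log_le_log (Finset.prod_pos fun i _ => hv.norm_pos i) hv.prod_norm_le

lemma neg_log_le_logMinimum_add_dual (τ : traceZero d) (Λ : Submodule ℤ (Fin d → ℝ))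
    [DiscreteTopology Λ] [IsZLattice ℝ Λ] {k : ℕ} (hk : k ∈ Set.Icc 1 d) :
    -Real.log d ≤ logMinimum k τ Λ + logMinimum (d + 1 - k) (-τ) (dualLattice Λ) := by
  obtain ⟨v, hv⟩ := exists_isMinimalFamily_diagonalFlow (τ : Fin d → ℝ) Λ
  obtain ⟨w, hw⟩ := exists_isMinimalFamily_diagonalFlow ((-τ : traceZero d) : Fin d → ℝ)
    (dualLattice Λ)
  obtain ⟨i, rfl⟩ := exists_fin_val_add_one_eq hk
  have rev_add_one : d + 1 - (i + 1) = (i.rev : ℕ) + 1 := by grind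
  have hd : (0 : ℝ) < d := Nat.cast_pos.2 i.pos
  rw [rev_add_one, hv.logMinimum_eq, hw.logMinimum_eq,
    ← Real.log_mul (hv.norm_pos _).ne' (hw.norm_pos _).ne', ← Real.log_inv]
  rw [NegMemClass.coe_neg, ← dualLattice_diagonalFlow] at hw
  exact Real.log_le_log (inv_pos.2 hd)
    ((inv_le_iff_one_le_mul₀' hd).2 (hv.one_le_mul_norm_rev hw i))

variable (Λ : Submodule ℤ (Fin d → ℝ)) [DiscreteTopology Λ] [IsZLattice ℝ Λ]

theorem exists_abs_logMinimum_add_dual_le :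
    ∃ C : ℝ, ∀ τ : traceZero d, ∀ k ∈ Set.Icc 1 d,
      |logMinimum k τ Λ + logMinimum (d + 1 - k) (-τ) (dualLattice Λ)| ≤ C := by
  set r := Real.log d
  set p := Real.log ((d : ℝ) ^ d * ZLattice.covolume Λ)
  set q := Real.log ((d : ℝ) ^ d * ZLattice.covolume (dualLattice Λ))
  have hr : 0 ≤ r := Real.log_natCast_nonneg d
  refine ⟨max r (p + q + d * r), fun τ k hk => ?_⟩
  let t (j : ℕ) : ℝ := logMinimum j τ Λ + logMinimum (d + 1 - j) (-τ) (dualLattice Λ) + r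
  have t_nonneg : ∀ j ∈ Finset.Icc 1 d, 0 ≤ t j := fun j hj =>
    neg_le_iff_add_nonneg.1 (neg_log_le_logMinimum_add_dual τ Λ (Finset.mem_Icc.1 hj))
  have sum_t_le : ∑ j ∈ Finset.Icc 1 d, t j ≤ p + q + d * r := by
    simp only [t, Finset.sum_add_distrib, Finset.sum_const, Nat.card_Icc, nsmul_eq_mul,
      add_tsub_cancel_right]
    rw [sum_Icc_one_reflect (fun j => logMinimum j (-τ) (dualLattice Λ)) le_rfl, Nat.sub_self]
    gcongr
    exacts [sum_logMinimum_le τ Λ, sum_logMinimum_le (-τ) (dualLattice Λ)]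
  have t_le : t k ≤ p + q + d * r :=
    (Finset.single_le_sum t_nonneg (Finset.mem_Icc.2 hk)).trans sum_t_le
  exact abs_le'.2 ⟨le_max_of_le_right (by linarith),
    le_max_of_le_left (neg_le.1 (neg_log_le_logMinimum_add_dual τ Λ hk))⟩

lemma exists_abs_sum_logMinimum_add_dual_le {k : ℕ} (hk : k ≤ d) :
    ∃ C : ℝ, ∀ τ : traceZero d,
      |∑ j ∈ Finset.Icc 1 k, logMinimum j τ Λ +
        ∑ j ∈ Finset.Ioc (d - k) d, logMinimum j (-τ) (dualLattice Λ)| ≤ C := by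
  obtain ⟨C, hC⟩ := exists_abs_logMinimum_add_dual_le Λ
  refine ⟨k * C, fun τ => ?_⟩
  rw [← sum_Icc_one_reflect _ hk, ← Finset.sum_add_distrib]
  refine (Finset.abs_sum_le_sum_abs _ _).trans
    ((Finset.sum_le_card_nsmul _ _ C fun j hj => ?_).trans_eq (by simp))
  exact hC τ j (Set.Icc_subset_Icc_right hk (Finset.mem_Icc.1 hj))

theorem exists_abs_sum_logMinimum_le :
    ∃ C : ℝ, ∀ τ : traceZero d, |∑ j ∈ Finset.Icc 1 d, logMinimum j τ Λ| ≤ C := by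
  obtain ⟨C, hC⟩ := exists_abs_sum_logMinimum_add_dual_le Λ le_rfl
  set p := Real.log ((d : ℝ) ^ d * ZLattice.covolume Λ)
  set q := Real.log ((d : ℝ) ^ d * ZLattice.covolume (dualLattice Λ))
  refine ⟨max p (C + q), fun τ => abs_le'.2
    ⟨le_max_of_le_left (sum_logMinimum_le τ Λ), le_max_of_le_right ?_⟩⟩
  have lower := neg_le_of_abs_le (hC τ)
  have dual_le : ∑ j ∈ Finset.Ioc 0 d, logMinimum j (-τ) (dualLattice Λ) ≤ q :=
    sum_logMinimum_le (-τ) (dualLattice Λ)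
  rw [Nat.sub_self] at lower
  linarith

theorem exists_abs_sum_logMinimum_sub_dual_le {k : ℕ} (hk : k ≤ d) :
    ∃ C : ℝ, ∀ τ : traceZero d,
      |∑ j ∈ Finset.Icc 1 k, logMinimum j τ Λ -
        ∑ j ∈ Finset.Icc 1 (d - k), logMinimum j (-τ) (dualLattice Λ)| ≤ C := by
  obtain ⟨C, hC⟩ := exists_abs_sum_logMinimum_add_dual_le Λ hk
  obtain ⟨C', hC'⟩ := exists_abs_sum_logMinimum_le (dualLattice Λ)
  refine ⟨C + C', fun τ => (le_of_eq (congrArg abs ?_)).trans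
    ((abs_sub _ _).trans (add_le_add (hC τ) (hC' (-τ))))⟩
  rw [← sum_Icc_one_sub_sum_Icc_one _ (Nat.sub_le d k)]
  ring

end LogMinima

section Exponents

lemma neBot_cobounded_traceZero (hd : 2 ≤ d) : (Bornology.cobounded (traceZero d)).NeBot := by
  have : NeZero d := ⟨by omega⟩
  have : Nontrivial (Fin d) := Fin.nontrivial_iff_two_le.2 hd
  obtain ⟨i, hi⟩ := exists_ne (0 : Fin d)
  have mem : Pi.single i 1 - Pi.single 0 1 ∈ traceZero d := by
    change ∑ j, _ = (0 : ℝ)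
    simp
  have : Nontrivial (traceZero d) := by
    refine ⟨⟨_, mem⟩, 0, fun h => ?_⟩
    simpa [hi] using congrFun (congrArg Subtype.val h) i
  exact NormedSpace.cobounded_neBot ℝ _

lemma IsExhausting.tendsto_atTop {f : traceZero d → ℝ} (hf : IsExhausting f) :
    Tendsto f (Bornology.cobounded (traceZero d)) atTop := by
  refine Filter.tendsto_atTop.2 fun r => ?_
  filter_upwards [Bornology.isBounded_def.1 (hf.isBounded_sublevel r)] with τ hτ
  have lt : r < f τ := by simpa using hτ
  exact lt.le

variable (k : ℕ) (Λ : Submodule ℤ (Fin d → ℝ)) (f A : traceZero d → ℝ)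

lemma lowerExp₁_eq : lowerExp₁ k Λ f =
    lowerRate (Bornology.cobounded (traceZero d)) f fun τ => logMinimum k τ Λ :=
  rfl

lemma upperExp₁_eq : upperExp₁ k Λ f =
    upperRate (Bornology.cobounded (traceZero d)) f fun τ => logMinimum k τ Λ :=
  rfl

lemma lowerExp₂_eq : lowerExp₂ k Λ f = lowerRate (Bornology.cobounded (traceZero d)) f
    fun τ => ∑ j ∈ Finset.Icc 1 k, logMinimum j τ Λ := by
  simp only [lowerExp₂, lowerRate, bigPsi, psi, Finset.sum_div]

lemma upperExp₂_eq : upperExp₂ k Λ f = upperRate (Bornology.cobounded (traceZero d)) f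
    fun τ => ∑ j ∈ Finset.Icc 1 k, logMinimum j τ Λ := by
  simp only [upperExp₂, upperRate, bigPsi, psi, Finset.sum_div]

lemma map_neg_cobounded_traceZero :
    map Neg.neg (Bornology.cobounded (traceZero d)) = Bornology.cobounded (traceZero d) :=
  neg_cobounded

lemma lowerRate_reflect : lowerRate (Bornology.cobounded (traceZero d)) (reflect f) A =
    lowerRate (Bornology.cobounded (traceZero d)) f fun τ => A (-τ) := by
  conv_lhs => rw [lowerRate, ← map_neg_cobounded_traceZero]
  simp only [lowerRate, liminf, Filter.map_map, Function.comp_def, reflect, neg_neg]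

lemma upperRate_reflect : upperRate (Bornology.cobounded (traceZero d)) (reflect f) A =
    upperRate (Bornology.cobounded (traceZero d)) f fun τ => A (-τ) := by
  conv_lhs => rw [upperRate, ← map_neg_cobounded_traceZero]
  simp only [upperRate, limsup, Filter.map_map, Function.comp_def, reflect, neg_neg]

end Exponents

end LatticeExponents

end

open LatticeExponents in
theorem mainTheorem7_general (d : ℕ) (hd : 2 ≤ d)
    (Λ : Submodule ℤ (Fin d → ℝ)) [DiscreteTopology Λ] [IsZLattice ℝ Λ]
    (f : traceZero d → ℝ) (hf : Tendsto f (Bornology.cobounded (traceZero d)) atTop) :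
    (∀ k : ℕ, 1 ≤ k → k ≤ d - 1 →
      lowerExp₁ k Λ f ≤ lowerExp₁ (k + 1) Λ f ∧
      upperExp₁ k Λ f ≤ upperExp₁ (k + 1) Λ f) ∧
    (lowerExp₂ 1 Λ f = lowerExp₁ 1 Λ f ∧
      lowerExp₁ 1 Λ f ≤ 0 ∧
      upperExp₂ 1 Λ f = upperExp₁ 1 Λ f ∧
      upperExp₁ 1 Λ f ≤ 0) ∧
    (lowerExp₂ (d - 1) Λ f = -upperExp₁ d Λ f ∧
      upperExp₂ (d - 1) Λ f = -lowerExp₁ d Λ f) ∧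
    (lowerExp₂ d Λ f = 0 ∧ upperExp₂ d Λ f = 0) ∧
    (∀ k : ℕ, 1 ≤ k → k ≤ d - 1 →
      ((((k : ℝ) + 1) / k : ℝ) : EReal) * lowerExp₂ k Λ f
          ≤ lowerExp₂ (k + 1) Λ f ∧
      lowerExp₂ (k + 1) Λ f
          ≤ ((((d : ℝ) - k - 1) / ((d : ℝ) - k) : ℝ) : EReal)
              * lowerExp₂ k Λ f ∧
      ((((d : ℝ) - k - 1) / ((d : ℝ) - k) : ℝ) : EReal)
          * lowerExp₂ k Λ f ≤ 0 ∧
      ((((k : ℝ) + 1) / k : ℝ) : EReal) * upperExp₂ k Λ f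
          ≤ upperExp₂ (k + 1) Λ f ∧
      upperExp₂ (k + 1) Λ f
          ≤ ((((d : ℝ) - k - 1) / ((d : ℝ) - k) : ℝ) : EReal)
              * upperExp₂ k Λ f ∧
      ((((d : ℝ) - k - 1) / ((d : ℝ) - k) : ℝ) : EReal)
          * upperExp₂ k Λ f ≤ 0) ∧
    ((((d : ℝ) - 1 : ℝ) : EReal) * lowerExp₂ 1 Λ f
          ≤ lowerExp₂ (d - 1) Λ f ∧
      lowerExp₂ (d - 1) Λ f
          ≤ lowerExp₂ 1 Λ f / (((d : ℝ) - 1 : ℝ) : EReal) ∧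
      (((d : ℝ) - 1 : ℝ) : EReal) * upperExp₂ 1 Λ f
          ≤ upperExp₂ (d - 1) Λ f ∧
      upperExp₂ (d - 1) Λ f
          ≤ upperExp₂ 1 Λ f / (((d : ℝ) - 1 : ℝ) : EReal)) ∧
    (∀ k : ℕ, 1 ≤ k → k ≤ d →
      lowerExp₁ k Λ f
          = -upperExp₁ (d + 1 - k) (dualLattice Λ)
              (reflect f) ∧
      upperExp₁ k Λ f
          = -lowerExp₁ (d + 1 - k) (dualLattice Λ)
              (reflect f)) ∧
    (∀ k : ℕ, 1 ≤ k → k ≤ d - 1 →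
      lowerExp₂ k Λ f
          = lowerExp₂ (d - k) (dualLattice Λ)
              (reflect f) ∧
      upperExp₂ k Λ f
          = upperExp₂ (d - k) (dualLattice Λ)
              (reflect f)) := by
  have := neBot_cobounded_traceZero hd
  have lower := isGrowthRate_lowerRate hf
  have upper := isGrowthRate_upperRate hf
  have mono τ := monotoneOn_logMinimum τ Λ
  obtain ⟨C, total⟩ := exists_abs_sum_logMinimum_le Λ
  obtain ⟨C', dual⟩ := exists_abs_logMinimum_add_dual_le Λ
  have pred_add_last τ :
      |∑ j ∈ Finset.Icc 1 (d - 1), logMinimum j τ Λ + logMinimum d τ Λ| ≤ C := by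
    rw [sum_Icc_one_pred_add (fun j => logMinimum j τ Λ) (by omega)]
    exact total τ
  simp only [lowerExp₁_eq, upperExp₁_eq, lowerExp₂_eq, upperExp₂_eq, lowerRate_reflect,
    upperRate_reflect]
  refine ⟨fun k hk hkd => ?_, ?_, ?_, ?_, fun k hk hkd => ?_, ?_, fun k hk hkd => ?_,
    fun k _ hkd => ?_⟩
  · have step τ := mono τ ⟨hk, by omega⟩ ⟨k.succ_pos, by omega⟩ k.le_succ
    exact ⟨lower.mono step, upper.mono step⟩
  · have hd' : 1 ≤ d := by omega
    simpa using And.intro (lower.sum_nonpos mono total hd') (upper.sum_nonpos mono total hd')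
  · exact ⟨lowerRate_eq_neg_upperRate hf pred_add_last,
      upperRate_eq_neg_lowerRate hf pred_add_last⟩
  · exact ⟨lower.eq_zero_of_bounded total, upper.eq_zero_of_bounded total⟩
  · simpa only [and_assoc] using And.intro (lower.sum_succ_bounds mono total hk (by omega))
      (upper.sum_succ_bounds mono total hk (by omega))
  · simpa only [and_assoc] using
      And.intro (lower.sum_pred_bounds mono total hd) (upper.sum_pred_bounds mono total hd)
  · exact ⟨lowerRate_eq_neg_upperRate hf fun τ => dual τ k ⟨hk, hkd⟩,
      upperRate_eq_neg_lowerRate hf fun τ => dual τ k ⟨hk, hkd⟩⟩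
  · obtain ⟨C'', dual_sum⟩ := exists_abs_sum_logMinimum_sub_dual_le Λ (k := k) (by omega)
    exact ⟨lower.congr dual_sum, upper.congr dual_sum⟩

theorem mainTheorem7 (d : ℕ) (hd : 2 ≤ d)
    (Λ : Submodule ℤ (Fin d → ℝ)) [DiscreteTopology Λ] [IsZLattice ℝ Λ]
    (hΛ : ZLattice.covolume Λ = 1)
    (f : LatticeExponents.traceZero d → ℝ) (hf : LatticeExponents.IsExhausting f) :
    (∀ k : ℕ, 1 ≤ k → k ≤ d - 1 →
      LatticeExponents.lowerExp₁ k Λ f ≤ LatticeExponents.lowerExp₁ (k + 1) Λ f ∧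
      LatticeExponents.upperExp₁ k Λ f ≤ LatticeExponents.upperExp₁ (k + 1) Λ f) ∧
    (LatticeExponents.lowerExp₂ 1 Λ f = LatticeExponents.lowerExp₁ 1 Λ f ∧
      LatticeExponents.lowerExp₁ 1 Λ f ≤ 0 ∧
      LatticeExponents.upperExp₂ 1 Λ f = LatticeExponents.upperExp₁ 1 Λ f ∧
      LatticeExponents.upperExp₁ 1 Λ f ≤ 0) ∧
    (LatticeExponents.lowerExp₂ (d - 1) Λ f = -LatticeExponents.upperExp₁ d Λ f ∧
      LatticeExponents.upperExp₂ (d - 1) Λ f = -LatticeExponents.lowerExp₁ d Λ f) ∧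
    (LatticeExponents.lowerExp₂ d Λ f = 0 ∧ LatticeExponents.upperExp₂ d Λ f = 0) ∧
    (∀ k : ℕ, 1 ≤ k → k ≤ d - 1 →
      ((((k : ℝ) + 1) / k : ℝ) : EReal) * LatticeExponents.lowerExp₂ k Λ f
          ≤ LatticeExponents.lowerExp₂ (k + 1) Λ f ∧
      LatticeExponents.lowerExp₂ (k + 1) Λ f
          ≤ ((((d : ℝ) - k - 1) / ((d : ℝ) - k) : ℝ) : EReal)
              * LatticeExponents.lowerExp₂ k Λ f ∧
      ((((d : ℝ) - k - 1) / ((d : ℝ) - k) : ℝ) : EReal)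
          * LatticeExponents.lowerExp₂ k Λ f ≤ 0 ∧
      ((((k : ℝ) + 1) / k : ℝ) : EReal) * LatticeExponents.upperExp₂ k Λ f
          ≤ LatticeExponents.upperExp₂ (k + 1) Λ f ∧
      LatticeExponents.upperExp₂ (k + 1) Λ f
          ≤ ((((d : ℝ) - k - 1) / ((d : ℝ) - k) : ℝ) : EReal)
              * LatticeExponents.upperExp₂ k Λ f ∧
      ((((d : ℝ) - k - 1) / ((d : ℝ) - k) : ℝ) : EReal)
          * LatticeExponents.upperExp₂ k Λ f ≤ 0) ∧
    ((((d : ℝ) - 1 : ℝ) : EReal) * LatticeExponents.lowerExp₂ 1 Λ f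
          ≤ LatticeExponents.lowerExp₂ (d - 1) Λ f ∧
      LatticeExponents.lowerExp₂ (d - 1) Λ f
          ≤ LatticeExponents.lowerExp₂ 1 Λ f / (((d : ℝ) - 1 : ℝ) : EReal) ∧
      (((d : ℝ) - 1 : ℝ) : EReal) * LatticeExponents.upperExp₂ 1 Λ f
          ≤ LatticeExponents.upperExp₂ (d - 1) Λ f ∧
      LatticeExponents.upperExp₂ (d - 1) Λ f
          ≤ LatticeExponents.upperExp₂ 1 Λ f / (((d : ℝ) - 1 : ℝ) : EReal)) ∧
    (∀ k : ℕ, 1 ≤ k → k ≤ d →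
      LatticeExponents.lowerExp₁ k Λ f
          = -LatticeExponents.upperExp₁ (d + 1 - k) (LatticeExponents.dualLattice Λ)
              (LatticeExponents.reflect f) ∧
      LatticeExponents.upperExp₁ k Λ f
          = -LatticeExponents.lowerExp₁ (d + 1 - k) (LatticeExponents.dualLattice Λ)
              (LatticeExponents.reflect f)) ∧
    (∀ k : ℕ, 1 ≤ k → k ≤ d - 1 →
      LatticeExponents.lowerExp₂ k Λ f
          = LatticeExponents.lowerExp₂ (d - k) (LatticeExponents.dualLattice Λ)
              (LatticeExponents.reflect f) ∧
      LatticeExponents.upperExp₂ k Λ f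
          = LatticeExponents.upperExp₂ (d - k) (LatticeExponents.dualLattice Λ)
              (LatticeExponents.reflect f)) :=
  mainTheorem7_general d hd Λ f hf.tendsto_atTop
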